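/- A full binary tree is a rooted plane tree in which every node has either no child (a leaf) or an ordered pair of children, left and right (an internal node). Traverse a full binary tree in post-order. Whenever the fringe subtree that is reached has already been seen during the traversal, replace the edge leading to it by a pointer to the existing copy (so only the first leaf is kept). The resulting plane directed acyclic graph is a \emph{compacted binary tree}; its \emph{size} is its number of internal nodes. Its \emph{spine} is the binary tree obtained by deleting all pointers and the leaf, and its \emph{right height} is the maximal number of right edges on a path in the spine from the root to a node ($0$ if the spine is empty). Let $c_{k,n}$ be the number of compacted binary trees of size $n$ and right height at most $k$. For every integer $k\ge 0$ there is a real constant $\kappa_k>0$, independent of $n$, such that, as $n\to\infty$, $$c_{k,n}\sim \kappa_k\, n!\,\Bigl(4\cos^2\bigl(\tfrac{\pi}{k+3}\bigr)\Bigr)^{n}\, n^{\alpha_k},\qquad \alpha_k=-\frac{k}{2}-\frac{1}{k+3}-\Bigl(\frac14-\frac1{k+3}\Bigr)\frac{1}{\cos^2\bigl(\frac{\pi}{k+3}\bigr)} .$$ Moreover, the critical exponent $\alpha_k$ is irrational if and only if $k\notin\{0,1,3\}$. -/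

import Mathlib

open Filter Asymptotics
open scoped Nat

namespace CompactedTree

/-- A full binary tree: `nil` is a leaf, and every `node` is an internal node with a left and a
right child. -/
abbrev FullTree : Type := BinaryTree Unit

/-- A plane binary tree with pointers. `leaf` is the leaf that is kept, `node` is an internal node,
and `pointer i` stands for an edge that points to the vertex with unique identifier `i`: the
identifier `0` belongs to the leaf, and the internal nodes are numbered `1, 2, …` in the order in
which the post-order traversal finishes them. -/
inductive PointerTree : Type
  | leaf : PointerTree
  | pointer (i : ℕ) : PointerTree
  | node (left right : PointerTree) : PointerTree

/-- The compaction procedure (post-order traversal). The list `seen` holds the distinct fringe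
subtrees discovered so far, in order of discovery; the position of a subtree in it is its unique
identifier. A subtree that has already been seen is replaced by a pointer to the existing one;
otherwise it is traversed (left child first, then right child) and then receives the next free
identifier. The procedure returns the compacted object and the updated list. -/
def compactAux : FullTree → List FullTree → PointerTree × List FullTree
  | .nil, seen =>
      if .nil ∈ seen then (.pointer (seen.idxOf .nil), seen)
      else (.leaf, seen ++ [.nil])
  | .node u l r, seen =>
      if .node u l r ∈ seen then (.pointer (seen.idxOf (.node u l r)), seen)
      else
        let a := compactAux l seen
        let b := compactAux r a.2
        (.node a.1 b.1, b.2 ++ [.node u l r])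

/-- The compacted form of a full binary tree: the traversal starts with nothing seen. -/
def compact (t : FullTree) : PointerTree := (compactAux t []).1

/-- A compacted binary tree is the result of the compaction of some full binary tree. -/
def IsCompacted (c : PointerTree) : Prop := ∃ t : FullTree, compact t = c

/-- The size: the number of internal nodes. -/
def PointerTree.size : PointerTree → ℕ
  | .leaf => 0
  | .pointer _ => 0
  | .node l r => l.size + r.size + 1

/-- The spine: the binary tree (a node may lack its left or its right child, shown by `nil`) that
remains when the pointers and the leaf are deleted. -/
def PointerTree.spine : PointerTree → BinaryTree Unit
  | .leaf => .nil
  | .pointer _ => .nil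
  | .node l r => .node () l.spine r.spine

/-- The maximal number of right edges on a path from the root of a binary tree to one of its nodes,
where `nil` is the absence of a node. -/
def maxRightEdges : BinaryTree Unit → ℕ
  | .nil => 0
  | .node _ l r => max (maxRightEdges l) (if r = .nil then 0 else maxRightEdges r + 1)

/-- The right height: the maximal number of right edges on a path in the spine from the root. -/
def PointerTree.rightHeight (c : PointerTree) : ℕ := maxRightEdges c.spine

/-- The number of compacted binary trees of size `n` and right height at most `k`. -/
noncomputable def count (k n : ℕ) : ℕ :=
  Set.ncard {c : PointerTree | IsCompacted c ∧ c.size = n ∧ c.rightHeight ≤ k}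

/-- The critical exponent
`-k/2 - 1/(k+3) - (1/4 - 1/(k+3)) / cos²(π/(k+3))`. -/
noncomputable def criticalExponent (k : ℕ) : ℝ :=
  -(k : ℝ) / 2 - 1 / ((k : ℝ) + 3)
    - (1 / 4 - 1 / ((k : ℝ) + 3)) * (1 / Real.cos (Real.pi / ((k : ℝ) + 3)) ^ 2)

end CompactedTree

/-! While a tree is traversed, the maximal subtrees already completed form a stack; a tree lying
over `h` others on the stack sits below `h` right edges. The top tree is either among the `m + 1`
trees already known (counting the leaf), or it is new, and then it results from joining the two top
trees of a stack with one internal node less, which may be any two trees except the children of one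
of the `m` known internal nodes. This gives a linear recursion in `m` for the numbers of stacks of
height at most `k + 1`, whose rescaled coefficients are analytic in `t = 1 / (m + 1)`.

The right height bound acts as an absorbing boundary, so the limiting matrix has Perron eigenvalue
`4 cos² (π / (k + 3))` with sines as eigenvectors. Perturbing the eigenvector to first order in `t`
is possible only if the perturbation is orthogonal to the left eigenvector, and this determines the
exponent `α_k`. The resulting approximate solution has relative error `O(m⁻²)`, which is summable.
Dividing by it makes the recursion nearly stochastic, with a column bounded below, so by Doeblin's
contraction argument the quotients converge to a common positive constant.

The exponent is a rational function of `cos (2π / (k + 3))` with rational coefficients, so its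
irrationality is a matter of Niven's theorem. -/

theorem mul_sub_le_sum_mul_sub_sum_mul {ι R : Type*} [Fintype ι] [Ring R] [PartialOrder R]
    [IsOrderedRing R] {p y : ι → R} {a δ : R} {j₀ : ι} (hp : ∀ j, 0 ≤ p j) (hδ : δ ≤ p j₀)
    (hy : ∀ j, a ≤ y j) : δ * (y j₀ - a) ≤ ∑ j, p j * y j - (∑ j, p j) * a :=
  calc δ * (y j₀ - a)
    _ ≤ p j₀ * (y j₀ - a) := mul_le_mul_of_nonneg_right hδ (sub_nonneg.2 (hy j₀))
    _ ≤ ∑ j, p j * (y j - a) :=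
      Finset.single_le_sum (f := fun j => p j * (y j - a))
        (fun j _ => mul_nonneg (hp j) (sub_nonneg.2 (hy j))) (Finset.mem_univ j₀)
    _ = _ := by simp only [mul_sub, Finset.sum_sub_distrib, Finset.sum_mul]

theorem exists_tendsto_of_succ_le_exp_mul {u ε : ℕ → ℝ} (hε : Summable ε) (hu : ∀ m, 0 ≤ u m)
    (h : ∀ m, u (m + 1) ≤ Real.exp (ε m) * u m) : ∃ a, Tendsto u atTop (nhds a) := by
  set E : ℕ → ℝ := fun m => Real.exp (∑ j ∈ Finset.range m, ε j) with hE
  have hE_pos (m) : 0 < E m := Real.exp_pos _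
  have hE_lim : Tendsto E atTop (nhds (Real.exp (∑' j, ε j))) :=
    (Real.continuous_exp.tendsto _).comp hε.hasSum.tendsto_sum_nat
  have hanti : Antitone fun m => u m / E m := antitone_nat_of_succ_le fun m => by
    rw [div_le_div_iff₀ (hE_pos _) (hE_pos m)]
    calc u (m + 1) * E m ≤ Real.exp (ε m) * u m * E m := by gcongr; exact h m
      _ = u m * E (m + 1) := by simp only [hE, Finset.sum_range_succ, Real.exp_add]; ring
  have hlim := tendsto_atTop_ciInf hanti
    ⟨0, Set.forall_mem_range.2 fun m => div_nonneg (hu m) (hE_pos m).le⟩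
  exact ⟨_, (hlim.mul hE_lim).congr fun m => div_mul_cancel₀ _ (hE_pos m).ne'⟩

theorem exists_pos_tendsto_of_envelope {lo hi ref ε : ℕ → ℝ} {δ : ℝ} (hδ : 0 < δ)
    (hε : Summable ε) (hpos : ∀ m, 0 < lo m) (hlo : ∀ m, lo m ≤ ref m) (hhi : ∀ m, ref m ≤ hi m)
    (hlo_succ : ∀ m, δ * (ref m - lo m) ≤ lo (m + 1) - Real.exp (-ε m) * lo m)
    (hhi_succ : ∀ m, δ * (hi m - ref m) ≤ Real.exp (ε m) * hi m - hi (m + 1)) :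
    ∃ κ > 0, Tendsto lo atTop (nhds κ) ∧ Tendsto hi atTop (nhds κ) := by
  have hlo_hi (m) : lo m ≤ hi m := (hlo m).trans (hhi m)
  obtain ⟨b, hb⟩ : ∃ b, Tendsto hi atTop (nhds b) :=
    exists_tendsto_of_succ_le_exp_mul hε (fun m => (hpos m).le.trans (hlo_hi m)) fun m =>
      sub_nonneg.1 ((mul_nonneg hδ.le (sub_nonneg.2 (hhi m))).trans (hhi_succ m))
  obtain ⟨c, hc⟩ : ∃ c, Tendsto (fun m => (lo m)⁻¹) atTop (nhds c) :=
    exists_tendsto_of_succ_le_exp_mul hε (fun m => (inv_pos.2 (hpos m)).le) fun m => by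
      have h := sub_nonneg.1 ((mul_nonneg hδ.le (sub_nonneg.2 (hlo m))).trans (hlo_succ m))
      calc (lo (m + 1))⁻¹ ≤ (Real.exp (-ε m) * lo m)⁻¹ :=
            inv_anti₀ (mul_pos (Real.exp_pos _) (hpos m)) h
        _ = Real.exp (ε m) * (lo m)⁻¹ := by rw [mul_inv, Real.exp_neg, inv_inv]
  have hbc : 1 ≤ b * c := ge_of_tendsto' (hb.mul hc) fun m => by
    simpa [div_eq_mul_inv] using (one_le_div (hpos m)).2 (hlo_hi m)
  have hc_pos : 0 < c :=
    (ge_of_tendsto' hc fun m => (inv_pos.2 (hpos m)).le).lt_of_ne (by rintro rfl; linarith)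
  have hlo_lim : Tendsto lo atTop (nhds c⁻¹) := by simpa using hc.inv₀ hc_pos.ne'
  have hgap : δ * (b - c⁻¹) ≤ 0 := by
    have hε0 : Tendsto ε atTop (nhds 0) := hε.tendsto_atTop_zero
    have hexp : Tendsto (fun m => Real.exp (ε m)) atTop (nhds 1) := by simpa using hε0.rexp
    have hexp_neg : Tendsto (fun m => Real.exp (-ε m)) atTop (nhds 1) := by
      simpa using hε0.neg.rexp
    have hbound := ((hexp.mul hb).sub (hb.comp (tendsto_add_atTop_nat 1))).add
      ((hlo_lim.comp (tendsto_add_atTop_nat 1)).sub (hexp_neg.mul hlo_lim))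
    rw [one_mul, one_mul, sub_self, sub_self, add_zero] at hbound
    refine le_of_tendsto_of_tendsto' ((hb.sub hlo_lim).const_mul δ) hbound fun m => ?_
    simpa only [← mul_add, sub_add_sub_cancel, Function.comp_apply]
      using add_le_add (hhi_succ m) (hlo_succ m)
  have hb_eq : b = c⁻¹ := le_antisymm (by nlinarith) (le_of_tendsto_of_tendsto' hlo_lim hb hlo_hi)
  exact ⟨c⁻¹, inv_pos.2 hc_pos, hlo_lim, hb_eq ▸ hb⟩

theorem exists_pos_tendsto_of_mulVec_of_forall {ι : Type*} [Fintype ι]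
    {P : ℕ → Matrix ι ι ℝ} {x : ℕ → ι → ℝ} {j₀ : ι} {δ : ℝ} {ε : ℕ → ℝ}
    (hx : ∀ m, x (m + 1) = (P m).mulVec (x m)) (hpos : ∀ m i, 0 < x m i)
    (hP : ∀ m i j, 0 ≤ P m i j) (hδ : 0 < δ) (hcol : ∀ m i, δ ≤ P m i j₀) (hε : Summable ε)
    (hsum_le : ∀ m i, ∑ j, P m i j ≤ Real.exp (ε m))
    (hle_sum : ∀ m i, Real.exp (-ε m) ≤ ∑ j, P m i j) :
    ∃ κ > 0, ∀ i, Tendsto (fun m => x m i) atTop (nhds κ) := by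
  have : Nonempty ι := ⟨j₀⟩
  have hlo_le (m i) : ⨅ i, x m i ≤ x m i := ciInf_le (Set.finite_range _).bddBelow i
  have hle_hi (m i) : x m i ≤ ⨆ i, x m i := le_ciSup (Set.finite_range _).bddAbove i
  have hlo_pos (m) : 0 < ⨅ i, x m i := by
    obtain ⟨i, hi⟩ := exists_eq_ciInf_of_finite (f := x m)
    exact hi ▸ hpos m i
  have hhi_pos (m) : 0 < ⨆ i, x m i := (hpos m j₀).trans_le (hle_hi m j₀)
  have hx_succ (m i) : x (m + 1) i = ∑ j, P m i j * x m j := by rw [hx]; rfl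
  obtain ⟨κ, hκ, hlo, hhi⟩ := exists_pos_tendsto_of_envelope (ref := fun m => x m j₀)
    (lo := fun m => ⨅ i, x m i) (hi := fun m => ⨆ i, x m i) hδ hε hlo_pos
    (fun m => hlo_le m j₀) (fun m => hle_hi m j₀)
    (fun m => by
      obtain ⟨i, hi⟩ := exists_eq_ciInf_of_finite (f := x (m + 1))
      have h := mul_sub_le_sum_mul_sub_sum_mul (hP m i) (hcol m i) (hlo_le m)
      rw [← hx_succ, hi] at h
      exact h.trans (by gcongr; exacts [(hlo_pos m).le, hle_sum m i]))
    (fun m => by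
      obtain ⟨i, hi⟩ := exists_eq_ciSup_of_finite (f := x (m + 1))
      have h := mul_sub_le_sum_mul_sub_sum_mul (y := -x m) (hP m i) (hcol m i)
        fun j => neg_le_neg (hle_hi m j)
      simp only [Pi.neg_apply, mul_neg, Finset.sum_neg_distrib, ← hx_succ, hi] at h
      have := mul_le_mul_of_nonneg_right (hsum_le m i) (hhi_pos m).le
      linarith)
  exact ⟨κ, hκ, fun i => tendsto_of_tendsto_of_tendsto_of_le_of_le hlo hhi
    (hlo_le · i) (hle_hi · i)⟩

theorem exists_pos_tendsto_of_mulVec {ι : Type*} [Fintype ι]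
    {P : ℕ → Matrix ι ι ℝ} {x : ℕ → ι → ℝ} (j₀ : ι)
    (hx : ∀ᶠ m in atTop, x (m + 1) = (P m).mulVec (x m)) (hpos : ∀ᶠ m in atTop, ∀ i, 0 < x m i)
    (hP : ∀ᶠ m in atTop, ∀ i j, 0 ≤ P m i j)
    (hcol : ∀ i, ∃ δ > 0, ∀ᶠ m in atTop, δ ≤ P m i j₀)
    (hsum : ∀ i, Summable fun m => ∑ j, P m i j - 1) :
    ∃ κ > 0, ∀ i, Tendsto (fun m => x m i) atTop (nhds κ) := by
  have : Nonempty ι := ⟨j₀⟩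
  choose δ hδ_pos hδ using hcol
  have hsum_pos (i) : ∀ᶠ m in atTop, 0 < ∑ j, P m i j := by
    filter_upwards [hP, hδ i] with m hPm hδm
    exact ((hδ_pos i).trans_le hδm).trans_le
      (Finset.single_le_sum (fun j _ => hPm i j) (Finset.mem_univ j₀))
  have hlog (i) : Summable fun m => |Real.log (∑ j, P m i j)| := by
    simpa using (Real.summable_log_one_add_of_summable (hsum i)).abs
  obtain ⟨N, hN⟩ := eventually_atTop.1 (hx.and (hpos.and (hP.and
    ((eventually_all.2 hδ).and (eventually_all.2 hsum_pos)))))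
  choose hx hpos hP hδ hsum_pos using fun m => hN (m + N) (Nat.le_add_left N m)
  have hδ_inf (i) : ⨅ i, δ i ≤ δ i := ciInf_le (Set.finite_range _).bddBelow i
  have habs_le (m i) : |Real.log (∑ j, P (m + N) i j)| ≤ ∑ i, |Real.log (∑ j, P (m + N) i j)| :=
    Finset.single_le_sum (f := fun i => |Real.log (∑ j, P (m + N) i j)|)
      (fun _ _ => abs_nonneg _) (Finset.mem_univ i)
  obtain ⟨κ, hκ, hlim⟩ := exists_pos_tendsto_of_mulVec_of_forall
    (P := fun m => P (m + N)) (x := fun m => x (m + N)) (δ := ⨅ i, δ i) (j₀ := j₀)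
    (ε := fun m => ∑ i, |Real.log (∑ j, P (m + N) i j)|)
    (fun m => by simpa only [Nat.add_right_comm] using hx m) hpos hP
    (by obtain ⟨i, hi⟩ := exists_eq_ciInf_of_finite (f := δ); exact hi ▸ hδ_pos i)
    (fun m i => (hδ_inf i).trans (hδ m i))
    (summable_sum fun i _ => (summable_nat_add_iff N).2 (hlog i))
    (fun m i => (Real.log_le_iff_le_exp (hsum_pos m i)).1 ((le_abs_self _).trans (habs_le m i)))
    (fun m i => (Real.le_log_iff_exp_le (hsum_pos m i)).1
      (neg_le.1 ((neg_le_abs _).trans (habs_le m i))))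
  exact ⟨κ, hκ, fun i => (tendsto_add_atTop_iff_nat N).1 (hlim i)⟩

namespace CompactedTree

theorem compactAux_fst_injective (s : List FullTree) :
    Function.Injective fun t => (compactAux t s).1 := by
  intro t t' h
  simp only at h
  fun_induction compactAux t s generalizing t' <;> cases t' <;> simp only [compactAux] at h <;>
    split_ifs at h <;> grind [List.idxOf_inj]

/-- The number of internal nodes among the trees seen so far. -/
def nodesSeen (s : List FullTree) : ℕ := s.countP (· ≠ .nil)

theorem nodesSeen_compactAux (t : FullTree) (s : List FullTree) :
    nodesSeen (compactAux t s).2 = nodesSeen s + (compactAux t s).1.size := by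
  fun_induction compactAux t s <;> simp_all +zetaDelta [nodesSeen, PointerTree.size, add_assoc]

theorem subset_compactAux (t : FullTree) (s : List FullTree) : s ⊆ (compactAux t s).2 := by
  fun_induction compactAux t s <;> grind

theorem self_mem_compactAux (t : FullTree) (s : List FullTree) : t ∈ (compactAux t s).2 := by
  fun_cases compactAux t s <;> simp_all

theorem numNodes_le_of_mem_compactAux {t t' : FullTree} {s : List FullTree}
    (h : t' ∈ (compactAux t s).2) : t' ∈ s ∨ t'.numNodes ≤ t.numNodes := by
  fun_induction compactAux t s <;> grind [BinaryTree.numNodes]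

/-- A list of distinct trees that contains the children of each of its members. -/
structure IsPool (s : List FullTree) : Prop where
  nodup : s.Nodup
  children_mem : ∀ {l r : FullTree}, BinaryTree.node () l r ∈ s → l ∈ s ∧ r ∈ s

theorem IsPool.append_singleton {s : List FullTree} (hs : IsPool s) {t : FullTree} (ht : t ∉ s)
    (hchildren : ∀ l r, t = .node () l r → l ∈ s ∧ r ∈ s) : IsPool (s ++ [t]) where
  nodup := hs.nodup.append (List.nodup_singleton t) (List.disjoint_singleton.2 ht)
  children_mem {l r} h := by
    rcases List.mem_append.1 h with h | h
    · exact (hs.children_mem h).imp (List.mem_append_left _) (List.mem_append_left _)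
    · exact (hchildren l r (List.mem_singleton.1 h).symm).imp (List.mem_append_left _)
        (List.mem_append_left _)

theorem IsPool.compactAux {s : List FullTree} (hs : IsPool s) (t : FullTree) :
    IsPool (compactAux t s).2 := by
  fun_induction CompactedTree.compactAux t s with
  | case1 => exact hs
  | case2 s h => exact hs.append_singleton h (by simp)
  | case3 => exact hs
  | case4 u l r s h a b ihl ihr =>
    have hl : l ∈ b.2 := subset_compactAux _ _ (self_mem_compactAux _ _)
    have hr : r ∈ b.2 := self_mem_compactAux _ _
    refine (ihr (ihl hs)).append_singleton (fun hmem => ?_) (by rintro _ _ ⟨⟩; exact ⟨hl, hr⟩)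
    have hlt : l.numNodes < (BinaryTree.node u l r).numNodes ∧
        r.numNodes < (BinaryTree.node u l r).numNodes := by
      constructor <;> simp only [BinaryTree.numNodes] <;> omega
    rcases numNodes_le_of_mem_compactAux hmem with hmem | hle
    · exact (numNodes_le_of_mem_compactAux hmem).elim h hlt.1.not_ge
    · exact hlt.2.not_ge hle

theorem IsPool.ncard_ne_nil {s : List FullTree} (hs : IsPool s) :
    {t | t ∈ s ∧ t ≠ .nil}.ncard = nodesSeen s := by
  rw [nodesSeen, List.countP_eq_length_filter, ← List.toFinset_card_of_nodup (hs.nodup.filter _),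
    ← Set.ncard_coe_finset]
  congr 1
  ext t
  simp

theorem finite_setOf_mem_or_eq_nil (s : List FullTree) : {t | t ∈ s ∨ t = .nil}.Finite :=
  s.finite_toSet.union (Set.finite_singleton _)

theorem IsPool.ncard_mem_or_eq_nil {s : List FullTree} (hs : IsPool s) :
    {t | t ∈ s ∨ t = .nil}.ncard = nodesSeen s + 1 := by
  have hfin : {t | t ∈ s ∧ t ≠ .nil}.Finite := s.finite_toSet.subset fun _ h => h.1
  rw [← hs.ncard_ne_nil, ← Set.ncard_insert_of_notMem (fun h => h.2 rfl) hfin]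
  congr 1
  ext t
  by_cases ht : t = .nil <;> simp [ht]

theorem compactAux_node_of_notMem {l r : FullTree} {s : List FullTree}
    (h : BinaryTree.node () l r ∉ s) :
    compactAux (.node () l r) s =
      (.node (compactAux l s).1 (compactAux r (compactAux l s).2).1,
        (compactAux r (compactAux l s).2).2 ++ [.node () l r]) := by
  simp [compactAux, h]

theorem nodesSeen_compactAux_node_of_notMem {l r : FullTree} {s : List FullTree}
    (h : BinaryTree.node () l r ∉ s) : nodesSeen (compactAux (.node () l r) s).2 =
      nodesSeen (compactAux r (compactAux l s).2).2 + 1 := by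
  simp [compactAux_node_of_notMem h, nodesSeen]

theorem spine_compactAux_eq_nil {t : FullTree} {s : List FullTree} (h : t ∈ s ∨ t = .nil) :
    (compactAux t s).1.spine = .nil := by
  fun_cases compactAux t s <;> simp_all [PointerTree.spine]

theorem nodesSeen_compactAux_of_mem_or_eq_nil {t : FullTree} {s : List FullTree}
    (h : t ∈ s ∨ t = .nil) : nodesSeen (compactAux t s).2 = nodesSeen s := by
  fun_cases compactAux t s <;> simp_all [nodesSeen]

end CompactedTree

theorem ncard_biUnion_image_eq_mul {α β γ : Type*} {S : Set α} (hS : S.Finite) {T : α → Set β}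
    (hT : ∀ a ∈ S, (T a).Finite) {c : ℕ} (hc : ∀ a ∈ S, (T a).ncard = c) {f : α → β → γ}
    (hf : ∀ a b a' b', b ∈ T a → b' ∈ T a' → f a b = f a' b' → a = a' ∧ b = b') :
    (⋃ a ∈ S, f a '' T a).ncard = c * S.ncard := by
  have hcard : ∀ a ∈ S, (f a '' T a).ncard = c := fun a ha =>
    hc a ha ▸ Set.InjOn.ncard_image fun b hb b' hb' h => (hf a b a b' hb hb' h).2
  have hdisj : S.PairwiseDisjoint fun a => f a '' T a := by
    rintro a - a' - hne
    refine Set.disjoint_left.2 ?_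
    rintro _ ⟨b, hb, rfl⟩ ⟨b', hb', h⟩
    exact hne (hf a b a' b' hb hb' h.symm).1
  rw [hS.ncard_biUnion (fun a ha => (hT a ha).image _) hdisj, finsum_mem_congr rfl hcard,
    finsum_mem_eq_finite_toFinset_sum _ hS, Finset.sum_const, ← Set.ncard_eq_toFinset_card S hS,
    smul_eq_mul, mul_comm]

namespace CompactedTree

/-- The list of trees seen after the trees of a stack (top first) have been traversed. -/
def seenAfter : List FullTree → List FullTree
  | [] => []
  | t :: L => (compactAux t (seenAfter L)).2

theorem isPool_seenAfter (L : List FullTree) : IsPool (seenAfter L) := by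
  induction L with
  | nil => exact ⟨List.nodup_nil, by simp [seenAfter]⟩
  | cons t L ih => exact ih.compactAux t

/-- The bound `k` on the right height holds for a tree whose root lies below `d` right edges; an
absent tree always fits. -/
def FitsBelow (k d : ℕ) (T : BinaryTree Unit) : Prop := T = .nil ∨ maxRightEdges T + d ≤ k

theorem fitsBelow_node {k d : ℕ} {a b : BinaryTree Unit} :
    FitsBelow k d (.node () a b) ↔ d ≤ k ∧ FitsBelow k d a ∧ FitsBelow k (d + 1) b := by
  cases a <;> cases b <;> simp [FitsBelow, maxRightEdges] <;> omega

/-- Each tree of the stack respects the bound `k` on the right height. A stack lists, last one on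
top, the trees completed by a traversal that still await their parent or their right sibling, so a
tree lying over `d` others sits below `d` right edges. -/
def IsAdmissible (k : ℕ) : List FullTree → Prop
  | [] => True
  | t :: L => IsAdmissible k L ∧ FitsBelow k L.length (compactAux t (seenAfter L)).1.spine

/-- The admissible stacks of `h` trees with `m` internal nodes seen. -/
def stackSet (k m h : ℕ) : Set (List FullTree) :=
  {L | L.length = h ∧ IsAdmissible k L ∧ nodesSeen (seenAfter L) = m}

theorem stackSet_zero_right (k m : ℕ) : stackSet k m 0 = if m = 0 then {[]} else ∅ := by
  ext L
  cases L <;> split_ifs <;> simp_all [stackSet, IsAdmissible, seenAfter, nodesSeen, eq_comm]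

theorem cons_mem_stackSet_of_seen {k m h : ℕ} {t : FullTree} {L : List FullTree}
    (ht : t ∈ seenAfter L ∨ t = .nil) : t :: L ∈ stackSet k m (h + 1) ↔ L ∈ stackSet k m h := by
  simp [stackSet, IsAdmissible, FitsBelow, seenAfter, spine_compactAux_eq_nil ht,
    nodesSeen_compactAux_of_mem_or_eq_nil ht]

theorem node_cons_mem_stackSet_of_notMem {k m h : ℕ} {l r : FullTree} {L : List FullTree}
    (hnew : BinaryTree.node () l r ∉ seenAfter L) :
    .node () l r :: L ∈ stackSet k (m + 1) (h + 1) ↔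
      h ≤ k ∧ r :: l :: L ∈ stackSet k m (h + 2) := by
  have hseen := nodesSeen_compactAux_node_of_notMem hnew
  simp only [stackSet, IsAdmissible, seenAfter, Set.mem_ofPred_eq, List.length_cons, hseen]
  rw [compactAux_node_of_notMem hnew, PointerTree.spine, fitsBelow_node]
  constructor
  · rintro ⟨hlen, ⟨hL, hk, hl, hr⟩, hm⟩
    exact ⟨by omega, by omega, ⟨⟨hL, hl⟩, hr⟩, by omega⟩
  · rintro ⟨hk, hlen, ⟨⟨hL, hl⟩, hr⟩, hm⟩
    exact ⟨by omega, ⟨hL, by omega, hl, hr⟩, by omega⟩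

theorem count_eq_ncard_stackSet (k n : ℕ) : count k n = (stackSet k n 1).ncard := by
  have hmem (t : FullTree) : [t] ∈ stackSet k n 1 ↔
      (compact t).size = n ∧ (compact t).rightHeight ≤ k := by
    have hfits : FitsBelow k 0 (compact t).spine ↔ (compact t).rightHeight ≤ k := by
      unfold FitsBelow PointerTree.rightHeight
      constructor
      · rintro (h | h)
        · simp [h, maxRightEdges]
        · exact h
      · exact .inr
    have hsize : nodesSeen (compactAux t []).2 = (compact t).size := by
      simpa [nodesSeen, compact] using nodesSeen_compactAux t []
    rw [← hfits, and_comm, ← hsize]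
    simp [stackSet, IsAdmissible, seenAfter, compact]
  have himage : {c : PointerTree | IsCompacted c ∧ c.size = n ∧ c.rightHeight ≤ k} =
      (fun L => compact (L.headD .nil)) '' stackSet k n 1 := by
    ext c
    constructor
    · rintro ⟨⟨t, rfl⟩, ht⟩
      exact ⟨[t], (hmem t).2 ht, rfl⟩
    · rintro ⟨L, hL, rfl⟩
      obtain ⟨t, rfl⟩ := List.length_eq_one_iff.1 hL.1
      exact ⟨⟨t, rfl⟩, (hmem t).1 hL⟩
  rw [count, himage, Set.InjOn.ncard_image]
  rintro L ⟨hL, -⟩ L' ⟨hL', -⟩ h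
  obtain ⟨t, rfl⟩ := List.length_eq_one_iff.1 hL
  obtain ⟨t', rfl⟩ := List.length_eq_one_iff.1 hL'
  exact congrArg (fun t => [t]) (compactAux_fst_injective [] h)

/-- The top of the stack is an internal node of the compacted object. -/
def IsFresh : List FullTree → Prop
  | .node _ l r :: L => .node () l r ∉ seenAfter L
  | _ => False

theorem not_isFresh_cons {t : FullTree} {L : List FullTree} :
    ¬ IsFresh (t :: L) ↔ t ∈ seenAfter L ∨ t = .nil := by
  cases t <;> simp [IsFresh]

/-- The admissible stacks whose top has just been completed. -/
def freshStacks (k m h : ℕ) : Set (List FullTree) := {L ∈ stackSet k m h | IsFresh L}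

theorem freshStacks_zero_left (k h : ℕ) : freshStacks k 0 h = ∅ := by
  refine Set.eq_empty_of_forall_notMem fun L hL => ?_
  match L, hL with
  | .node _ l r :: L, ⟨hL, hnew⟩ =>
    have hm := hL.2.2
    rw [seenAfter, nodesSeen_compactAux_node_of_notMem hnew] at hm
    omega

theorem freshStacks_zero_right (k m : ℕ) : freshStacks k m 0 = ∅ := by
  refine Set.eq_empty_of_forall_notMem fun L hL => ?_
  match L, hL with
  | _ :: _, ⟨hL, _⟩ => simp [stackSet] at hL

theorem stackSet_sep_not_isFresh (k m h : ℕ) : {L ∈ stackSet k m (h + 1) | ¬ IsFresh L} =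
    ⋃ L ∈ stackSet k m h, (fun t => t :: L) '' {t | t ∈ seenAfter L ∨ t = .nil} := by
  ext L
  simp only [Set.mem_iUnion, Set.mem_image, Set.mem_ofPred_eq, exists_prop]
  constructor
  · rintro ⟨hL, hfresh⟩
    cases L with
    | nil => simp [stackSet] at hL
    | cons t L =>
      have ht := not_isFresh_cons.1 hfresh
      exact ⟨L, (cons_mem_stackSet_of_seen ht).1 hL, t, ht, rfl⟩
  · rintro ⟨L, hL, t, ht, rfl⟩
    exact ⟨(cons_mem_stackSet_of_seen ht).2 hL, not_isFresh_cons.2 ht⟩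

/-- Stacks whose two top trees are the children of a tree that is not seen yet. -/
def IsJoinable : List FullTree → Prop
  | r :: l :: L => BinaryTree.node () l r ∉ seenAfter L
  | _ => False

/-- Join the two top trees of a stack, the upper one becoming the right child. -/
def join : List FullTree → List FullTree
  | r :: l :: L => .node () l r :: L
  | L => L

theorem join_injOn : Set.InjOn join {L | IsJoinable L} := by
  intro L hL L' hL' h
  match L, hL, L', hL' with
  | r :: l :: L, _, r' :: l' :: L', _ => simp_all [join]

theorem freshStacks_succ_succ_of_le {k h : ℕ} (hh : h ≤ k) (m : ℕ) :
    freshStacks k (m + 1) (h + 1) = join '' {L ∈ stackSet k m (h + 2) | IsJoinable L} := by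
  ext L
  constructor
  · intro hL
    match L, hL with
    | .node _ l r :: L, ⟨hL, hnew⟩ =>
      exact ⟨r :: l :: L, ⟨((node_cons_mem_stackSet_of_notMem hnew).1 hL).2, hnew⟩, rfl⟩
  · rintro ⟨L, hL, rfl⟩
    match L, hL with
    | r :: l :: L, ⟨hL, hnew⟩ =>
      exact ⟨(node_cons_mem_stackSet_of_notMem hnew).2 ⟨hh, hL⟩, hnew⟩

theorem freshStacks_succ_succ_of_lt {k h : ℕ} (hh : k < h) (m : ℕ) :
    freshStacks k (m + 1) (h + 1) = ∅ := by
  refine Set.eq_empty_of_forall_notMem fun L hL => ?_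
  match L, hL with
  | .node _ l r :: L, ⟨hL, hnew⟩ => exact hh.not_ge ((node_cons_mem_stackSet_of_notMem hnew).1 hL).1

theorem stackSet_sep_not_isJoinable (k m h : ℕ) : {L ∈ stackSet k m (h + 2) | ¬ IsJoinable L} =
    ⋃ L ∈ stackSet k m h, (fun t => t.right :: t.left :: L) ''
      {t | t ∈ seenAfter L ∧ t ≠ .nil} := by
  have hiff {l r : FullTree} {L : List FullTree} (hmem : BinaryTree.node () l r ∈ seenAfter L) :
      r :: l :: L ∈ stackSet k m (h + 2) ↔ L ∈ stackSet k m h := by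
    obtain ⟨hl, hr⟩ := (isPool_seenAfter L).children_mem hmem
    have hr' : r ∈ seenAfter (l :: L) := subset_compactAux _ _ hr
    rw [cons_mem_stackSet_of_seen (.inl hr'), cons_mem_stackSet_of_seen (.inl hl)]
  ext L
  simp only [Set.mem_iUnion, Set.mem_image, Set.mem_ofPred_eq, exists_prop]
  constructor
  · rintro ⟨hL, hjoin⟩
    match L, hL, hjoin with
    | [], hL, _ | [_], hL, _ => simp [stackSet] at hL
    | r :: l :: L, hL, hjoin =>
      have hmem : BinaryTree.node () l r ∈ seenAfter L := not_not.1 hjoin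
      exact ⟨L, (hiff hmem).1 hL, .node () l r, ⟨hmem, by simp⟩, rfl⟩
  · rintro ⟨L, hL, t, ⟨hmem, hne⟩, rfl⟩
    cases t with
    | nil => exact (hne rfl).elim
    | node _ l r => exact ⟨(hiff hmem).2 hL, not_not.2 hmem⟩

theorem finite_stackSet (k m h : ℕ) : (stackSet k m h).Finite := by
  have hstep (m : ℕ) (hfresh : ∀ h, (freshStacks k m h).Finite) (h : ℕ) :
      (stackSet k m h).Finite := by
    induction h with
    | zero => rw [stackSet_zero_right]; split_ifs <;> simp
    | succ h ih =>
      refine (hfresh (h + 1)).union (t := {L ∈ stackSet k m (h + 1) | ¬ IsFresh L}) ?_ |>.subset ?_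
      · rw [stackSet_sep_not_isFresh]
        exact ih.biUnion fun L _ => (finite_setOf_mem_or_eq_nil (seenAfter L)).image _
      · exact fun L hL => (em (IsFresh L)).imp (⟨hL, ·⟩) (⟨hL, ·⟩)
  refine hstep m (fun h => ?_) h
  induction m generalizing h with
  | zero => simp [freshStacks_zero_left]
  | succ m ih =>
    cases h with
    | zero => simp [freshStacks_zero_right]
    | succ h =>
      rcases le_or_gt h k with hh | hh
      · rw [freshStacks_succ_succ_of_le hh]
        exact ((hstep m (ih ·) _).subset (Set.sep_subset _ _)).image _
      · simp [freshStacks_succ_succ_of_lt hh]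

theorem ncard_stackSet_succ (k m h : ℕ) : (stackSet k m (h + 1)).ncard =
    (freshStacks k m (h + 1)).ncard + (m + 1) * (stackSet k m h).ncard := by
  have hseen : {L ∈ stackSet k m (h + 1) | ¬ IsFresh L}.ncard =
      (m + 1) * (stackSet k m h).ncard := by
    rw [stackSet_sep_not_isFresh]
    refine ncard_biUnion_image_eq_mul (finite_stackSet k m h)
      (fun L _ => finite_setOf_mem_or_eq_nil (seenAfter L))
      (fun L hL => by rw [(isPool_seenAfter L).ncard_mem_or_eq_nil, hL.2.2]) ?_
    rintro L t L' t' - - h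
    exact (List.cons.inj h).symm
  rw [← hseen]
  exact (Set.ncard_inter_add_ncard_sdiff_eq_ncard _ {L | IsFresh L} (finite_stackSet k m _)).symm

theorem ncard_freshStacks_succ_succ {k h : ℕ} (hh : h ≤ k) (m : ℕ) :
    (freshStacks k (m + 1) (h + 1)).ncard + m * (stackSet k m h).ncard =
      (stackSet k m (h + 2)).ncard := by
  have hseen : {L ∈ stackSet k m (h + 2) | ¬ IsJoinable L}.ncard = m * (stackSet k m h).ncard := by
    rw [stackSet_sep_not_isJoinable]
    refine ncard_biUnion_image_eq_mul (finite_stackSet k m h)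
      (fun L _ => (seenAfter L).finite_toSet.subset fun _ ht => ht.1)
      (fun L hL => by rw [(isPool_seenAfter L).ncard_ne_nil, hL.2.2]) ?_
    rintro L t L' t' ⟨-, ht⟩ ⟨-, ht'⟩ h
    cases t <;> cases t' <;> simp_all
  rw [← hseen, freshStacks_succ_succ_of_le hh, (join_injOn.mono fun _ h => h.2).ncard_image]
  exact Set.ncard_inter_add_ncard_sdiff_eq_ncard _ {L | IsJoinable L} (finite_stackSet k m _)

end CompactedTree

open Real in
theorem sin_add_two_mul (x y : ℝ) :
    sin ((x + 2) * y) = 2 * cos y * sin ((x + 1) * y) - sin (x * y) := by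
  rw [show (x + 2) * y = (x + 1) * y + y by ring, show x * y = (x + 1) * y - y by ring,
    sin_add, sin_sub]
  ring

open Real in
theorem sin_mul_sum_sin_mul_sin_succ (θ : ℝ) (n : ℕ) :
    sin θ * ∑ h ∈ Finset.range n, sin (h * θ) * sin ((h + 1) * θ) =
      sin θ * (n / 2 * cos θ) - sin (2 * (n * θ)) / 4 := by
  induction n with
  | zero => simp
  | succ n ih =>
    rw [Finset.sum_range_succ, mul_add, ih]
    push_cast
    rw [show 2 * (((n : ℝ) + 1) * θ) = 2 * (n * θ) + 2 * θ by ring, add_mul _ _ θ, one_mul]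
    simp only [sin_add, sin_two_mul, cos_two_mul]
    linear_combination (sin (n * θ) * cos (n * θ)) * sin_sq_add_cos_sq θ +
      (sin θ * cos θ) * sin_sq_add_cos_sq (n * θ)

theorem sum_range_mul_of_reflect {f : ℕ → ℝ} {n : ℕ}
    (hf : ∀ h < n, f (n - 1 - h) = f h) :
    ∑ h ∈ Finset.range n, (h : ℝ) * f h = (n - 1) / 2 * ∑ h ∈ Finset.range n, f h := by
  have hreflect : ∑ h ∈ Finset.range n, ((n - 1 : ℝ) - h) * f h =
      ∑ h ∈ Finset.range n, (h : ℝ) * f h := by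
    rw [← Finset.sum_range_reflect]
    refine Finset.sum_congr rfl fun h hh => ?_
    have hh := Finset.mem_range.1 hh
    rw [hf h hh, Nat.cast_sub (by omega), Nat.cast_sub (by omega), Nat.cast_one,
      sub_sub_cancel]
  simp only [sub_mul, Finset.sum_sub_distrib, ← Finset.mul_sum] at hreflect
  linarith

namespace CompactedTree

/-- The angle `π / (k + 3)` of the theorem. -/
noncomputable def angle (k : ℕ) : ℝ := Real.pi / (k + 3)

/-- The exponential growth rate `4 cos² (π / (k + 3))`, the Perron eigenvalue of the limiting
recursion. -/
noncomputable def growth (k : ℕ) : ℝ := 4 * Real.cos (angle k) ^ 2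

/-- The partial sums of the right Perron eigenvector of the limiting recursion: the eigenvector
itself is `i ↦ perronSum k (i + 1) - perronSum k i`. -/
noncomputable def perronSum (k h : ℕ) : ℝ :=
  (2 * Real.cos (angle k)) ^ (h + 1) * Real.sin (h * angle k)

/-- The left Perron eigenvector of the limiting recursion, for the recursion written in terms of
partial sums. -/
noncomputable def leftPerron (k h : ℕ) : ℝ :=
  Real.sin (h * angle k) / (2 * Real.cos (angle k)) ^ h

variable {k h : ℕ}

theorem angle_pos (k : ℕ) : 0 < angle k := by unfold angle; positivity

theorem add_three_mul_angle (k : ℕ) : ((k : ℝ) + 3) * angle k = Real.pi := by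
  unfold angle; field_simp

theorem cos_angle_pos (k : ℕ) : 0 < Real.cos (angle k) := by
  have hpi := add_three_mul_angle k
  have hpos := angle_pos k
  have hk : 0 ≤ (k : ℝ) * angle k := by positivity
  exact Real.cos_pos_of_mem_Ioo ⟨by linarith [Real.pi_pos], by linarith⟩

theorem sin_mul_angle_pos (h0 : 0 < h) (hk : h < k + 3) : 0 < Real.sin (h * angle k) := by
  have hpos := angle_pos k
  refine Real.sin_pos_of_pos_of_lt_pi (by positivity) ?_
  rw [← add_three_mul_angle k]
  gcongr
  exact_mod_cast hk

theorem growth_pos (k : ℕ) : 0 < growth k := by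
  have := cos_angle_pos k
  unfold growth; positivity

theorem perronSum_zero (k : ℕ) : perronSum k 0 = 0 := by simp [perronSum]

theorem perronSum_add_two (k h : ℕ) :
    perronSum k (h + 2) = growth k * (perronSum k (h + 1) - perronSum k h) := by
  unfold perronSum growth
  push_cast
  rw [sin_add_two_mul]
  ring

theorem perronSum_succ_sub_pos (hh : h ≤ k) : 0 < perronSum k (h + 1) - perronSum k h := by
  have hpos : 0 < perronSum k (h + 2) :=
    mul_pos (pow_pos (by linarith [cos_angle_pos k]) _)
      (sin_mul_angle_pos (by omega) (by omega))
  rw [perronSum_add_two] at hpos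
  exact pos_of_mul_pos_right hpos (growth_pos k).le

theorem perronSum_top (k : ℕ) : perronSum k (k + 2) = perronSum k (k + 1) := by
  have hzero : perronSum k (k + 3) = 0 := by
    simp [perronSum, add_three_mul_angle]
  rw [perronSum_add_two k (k + 1)] at hzero
  exact sub_eq_zero.1 ((mul_eq_zero.1 hzero).resolve_left (growth_pos k).ne')

theorem leftPerron_add_growth_mul (k h : ℕ) :
    leftPerron k h + growth k * leftPerron k (h + 2) = growth k * leftPerron k (h + 1) := by
  have hc := (cos_angle_pos k).ne'
  unfold leftPerron growth
  push_cast
  rw [sin_add_two_mul]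
  field_simp
  ring

theorem growth_mul_leftPerron_top (k : ℕ) :
    growth k * leftPerron k (k + 2) = leftPerron k (k + 1) := by
  have hzero : leftPerron k (k + 3) = 0 := by
    simp [leftPerron, add_three_mul_angle]
  have hrec := leftPerron_add_growth_mul k (k + 1)
  rw [hzero] at hrec
  linarith

/-- The product `sin (hθ) sin ((h + 1)θ)`, `θ = π / (k + 3)`, in terms of which the pairing of the
left and right Perron eigenvectors is evaluated. -/
noncomputable def sinProd (k h : ℕ) : ℝ :=
  Real.sin (h * angle k) * Real.sin ((h + 1) * angle k)

theorem sinProd_zero (k : ℕ) : sinProd k 0 = 0 := by simp [sinProd]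

theorem sinProd_reflect (hh : h < k + 3) : sinProd k (k + 3 - 1 - h) = sinProd k h := by
  have hcast : ((k + 3 - 1 - h : ℕ) : ℝ) = k + 2 - h := by
    rw [Nat.add_sub_assoc (by omega), Nat.cast_sub (by omega)]
    push_cast
    ring
  have hpi := add_three_mul_angle k
  rw [sinProd, sinProd, hcast,
    show ((k : ℝ) + 2 - h) * angle k = Real.pi - (h + 1) * angle k by rw [← hpi]; ring,
    show ((k : ℝ) + 2 - h + 1) * angle k = Real.pi - h * angle k by rw [← hpi]; ring,
    Real.sin_pi_sub, Real.sin_pi_sub, mul_comm]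

theorem sinProd_add_two (k : ℕ) : sinProd k (k + 2) = 0 :=
  (sinProd_reflect (Nat.succ_pos _)).trans (sinProd_zero k)

theorem sinProd_add_one (k : ℕ) :
    sinProd k (k + 1) = 2 * Real.cos (angle k) * (1 - Real.cos (angle k) ^ 2) := by
  rw [show k + 1 = k + 3 - 1 - 1 from rfl, sinProd_reflect (by omega), sinProd]
  push_cast
  rw [one_mul, one_add_one_eq_two, Real.sin_two_mul]
  linear_combination 2 * Real.cos (angle k) * Real.sin_sq_add_cos_sq (angle k)

theorem sum_sinProd (k : ℕ) :
    ∑ h ∈ Finset.range (k + 3), sinProd k h = ((k : ℝ) + 3) / 2 * Real.cos (angle k) := by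
  have hsin : Real.sin (angle k) ≠ 0 := by
    simpa using (sin_mul_angle_pos (k := k) (h := 1) (by omega) (by omega)).ne'
  have hsum := sin_mul_sum_sin_mul_sin_succ (angle k) (k + 3)
  push_cast at hsum
  rw [add_three_mul_angle, Real.sin_two_pi, zero_div, sub_zero] at hsum
  exact mul_left_cancel₀ hsin hsum

theorem sum_mul_sinProd (k : ℕ) :
    ∑ h ∈ Finset.range (k + 3), (h : ℝ) * sinProd k h =
      ((k : ℝ) + 2) / 2 * (((k : ℝ) + 3) / 2 * Real.cos (angle k)) := by
  rw [sum_range_mul_of_reflect fun h hh => sinProd_reflect hh, sum_sinProd]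
  push_cast
  ring

/-- The inhomogeneity in the recursion for the first-order correction of the Perron eigenvector. -/
noncomputable def correctionSource (k h : ℕ) : ℝ :=
  (h + criticalExponent k) * perronSum k (h + 2) + perronSum k h

theorem leftPerron_succ_mul_perronSum (k h : ℕ) :
    leftPerron k (h + 1) * perronSum k h = sinProd k h := by
  have hc := (cos_angle_pos k).ne'
  unfold leftPerron perronSum sinProd
  push_cast
  field_simp

theorem leftPerron_succ_mul_perronSum_add_two (k h : ℕ) :
    leftPerron k (h + 1) * perronSum k (h + 2) = growth k * sinProd k (h + 1) := by
  have hc := (cos_angle_pos k).ne'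
  unfold leftPerron perronSum growth sinProd
  push_cast
  rw [show (h : ℝ) + 1 + 1 = h + 2 by ring]
  field_simp
  ring

theorem leftPerron_succ_mul_correctionSource (k h : ℕ) :
    leftPerron k (h + 1) * correctionSource k h =
      growth k * (((h + 1 : ℕ) : ℝ) * sinProd k (h + 1)) +
        growth k * (criticalExponent k - 1) * sinProd k (h + 1) + sinProd k h := by
  unfold correctionSource
  push_cast
  linear_combination leftPerron_succ_mul_perronSum k h +
    (h + criticalExponent k) * leftPerron_succ_mul_perronSum_add_two k h

-- The critical exponent is the unique value that makes the source orthogonal to the left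
-- eigenvector, hence the correction equation solvable.
theorem sum_leftPerron_mul_correctionSource (k : ℕ) :
    ∑ h ∈ Finset.range (k + 1), leftPerron k (h + 1) * correctionSource k h = 0 := by
  have hshift : ∑ h ∈ Finset.range (k + 1), sinProd k (h + 1) =
      ((k : ℝ) + 3) / 2 * Real.cos (angle k) := by
    rw [← sum_sinProd, Finset.sum_range_succ _ (k + 2), Finset.sum_range_succ' _ (k + 1),
      sinProd_zero, sinProd_add_two, add_zero, add_zero]
  have hmoment : ∑ h ∈ Finset.range (k + 1), ((h + 1 : ℕ) : ℝ) * sinProd k (h + 1) =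
      ((k : ℝ) + 2) / 2 * (((k : ℝ) + 3) / 2 * Real.cos (angle k)) := by
    rw [← sum_mul_sinProd, Finset.sum_range_succ _ (k + 2), Finset.sum_range_succ' _ (k + 1),
      sinProd_zero, sinProd_add_two, mul_zero, mul_zero, add_zero, add_zero]
  have hinit : ∑ h ∈ Finset.range (k + 1), sinProd k h =
      ((k : ℝ) + 3) / 2 * Real.cos (angle k) -
        2 * Real.cos (angle k) * (1 - Real.cos (angle k) ^ 2) := by
    rw [← sum_sinProd, ← sinProd_add_one, Finset.sum_range_succ _ (k + 2),
      Finset.sum_range_succ _ (k + 1), sinProd_add_two]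
    ring
  have hcos : Real.cos (angle k) ≠ 0 := (cos_angle_pos k).ne'
  have hcrit : criticalExponent k = -(k : ℝ) / 2 - 1 / (k + 3)
    - (1 / 4 - 1 / (k + 3)) * (1 / Real.cos (angle k) ^ 2) := rfl
  simp only [leftPerron_succ_mul_correctionSource, Finset.sum_add_distrib, ← Finset.mul_sum,
    hshift, hmoment, hinit]
  rw [hcrit, growth]
  field_simp
  ring

/-- The partial sums of the first-order correction of the Perron eigenvector. -/
noncomputable def correction (k : ℕ) : ℕ → ℝ
  | 0 => 0
  | 1 => 0
  | h + 2 => growth k * (correction k (h + 1) - correction k h) + correctionSource k h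

-- A discrete Wronskian identity: the left eigenvector solves the adjoint recursion.
theorem leftPerron_mul_correction_sub (k n : ℕ) :
    leftPerron k n * correction k (n + 1) - growth k * leftPerron k (n + 1) * correction k n =
      ∑ h ∈ Finset.range n, leftPerron k (h + 1) * correctionSource k h := by
  induction n with
  | zero => simp [correction]
  | succ n ih =>
    rw [Finset.sum_range_succ, ← ih, correction]
    linear_combination (-correction k (n + 1)) * leftPerron_add_growth_mul k n

theorem correction_top (k : ℕ) : correction k (k + 2) = correction k (k + 1) := by
  have hpos : 0 < leftPerron k (k + 1) :=
    div_pos (sin_mul_angle_pos (by omega) (by omega)) (pow_pos (by linarith [cos_angle_pos k]) _)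
  have hwronskian := leftPerron_mul_correction_sub k (k + 1)
  rw [sum_leftPerron_mul_correctionSource, growth_mul_leftPerron_top, ← mul_sub] at hwronskian
  exact sub_eq_zero.1 ((mul_eq_zero.1 hwronskian).resolve_left hpos.ne')

theorem irrational_cos_two_mul_angle {k : ℕ} (h0 : k ≠ 0) (h1 : k ≠ 1) (h3 : k ≠ 3) :
    Irrational (Real.cos (2 * angle k)) := by
  rintro ⟨q, hq⟩
  have hangle : 2 * angle k = ((2 / (k + 3) : ℚ) : ℝ) * Real.pi := by
    unfold angle; push_cast; ring
  have hmem : (2 / (k + 3) : ℚ) ∈ Set.Icc 0 1 :=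
    ⟨by positivity, (div_le_one (by positivity)).2 (by linarith [k.cast_nonneg (α := ℚ)])⟩
  have hk : (k : ℚ) + 3 ≠ 0 := by positivity
  rcases niven_angle_div_pi_eq ⟨q, by rw [← hangle, hq]⟩ hmem with h | h | h | h | (h : _ = _)
  · exact div_ne_zero two_ne_zero hk h
  all_goals field_simp at h; norm_cast at h; omega

theorem criticalExponent_eq_cos_two_mul_angle (k : ℕ) : criticalExponent k =
    -(k : ℝ) / 2 - 1 / (k + 3) - (k - 1) / (2 * (k + 3)) / (1 + Real.cos (2 * angle k)) := by
  have hcos := (cos_angle_pos k).ne'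
  change -(k : ℝ) / 2 - 1 / (k + 3)
    - (1 / 4 - 1 / (k + 3)) * (1 / Real.cos (angle k) ^ 2) = _
  rw [Real.cos_two_mul, add_sub_cancel]
  field_simp
  ring

theorem irrational_criticalExponent_iff (k : ℕ) :
    Irrational (criticalExponent k) ↔ k ≠ 0 ∧ k ≠ 1 ∧ k ≠ 3 := by
  refine ⟨fun h => ⟨?_, ?_, ?_⟩, fun ⟨h0, h1, h3⟩ => ?_⟩
  · rintro rfl
    exact h ⟨0, by norm_num [criticalExponent]⟩
  · rintro rfl
    exact h ⟨-3 / 4, by norm_num [criticalExponent]⟩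
  · rintro rfl
    exact h ⟨-16 / 9, by norm_num [criticalExponent, div_pow]⟩
  · have hk : ((k : ℚ) - 1) / (2 * (k + 3)) ≠ 0 :=
      div_ne_zero (sub_ne_zero.2 (by exact_mod_cast h1)) (by positivity)
    have := (((irrational_cos_two_mul_angle h0 h1 h3).natCast_add 1).ratCast_div hk).ratCast_sub
      (-(k : ℚ) / 2 - 1 / (k + 3))
    rw [criticalExponent_eq_cos_two_mul_angle]
    push_cast at this
    exact this

end CompactedTree

section AnalyticAt

variable {𝕜 : Type*} [NontriviallyNormedField 𝕜] [CharZero 𝕜] {z₀ : 𝕜}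

theorem isBigO_pow_of_iteratedDeriv_eq_zero {E : Type*} [NormedAddCommGroup E] [NormedSpace 𝕜 E]
    [CompleteSpace E] {f : 𝕜 → E} {n : ℕ} (hf : AnalyticAt 𝕜 f z₀)
    (hderiv : ∀ i < n, iteratedDeriv i f z₀ = 0) :
    f =O[nhds z₀] fun z => (z - z₀) ^ n := by
  obtain ⟨g, hg, hfg⟩ := (natCast_le_analyticOrderAt hf).1
    ((natCast_le_analyticOrderAt_iff_iteratedDeriv_eq_zero hf).2 hderiv)
  have hbound := (isBigO_refl (fun z => (z - z₀) ^ n) (nhds z₀)).smul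
    (hg.continuousAt.norm.isBoundedUnder_le.isBigO_one 𝕜)
  simpa using hbound.congr' (hfg.mono fun z hz => hz.symm) .rfl

theorem isBigO_div_sub_one_of_deriv_eq [CompleteSpace 𝕜] {f g : 𝕜 → 𝕜} (hf : AnalyticAt 𝕜 f z₀)
    (hg : AnalyticAt 𝕜 g z₀) (hg₀ : g z₀ ≠ 0) (hfg : f z₀ = g z₀)
    (hderiv : deriv f z₀ = deriv g z₀) :
    (fun z => f z / g z - 1) =O[nhds z₀] fun z => (z - z₀) ^ 2 := by
  refine isBigO_pow_of_iteratedDeriv_eq_zero ((hf.div hg hg₀).sub analyticAt_const) fun i hi => ?_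
  interval_cases i
  · simp [hfg, hg₀]
  · rw [iteratedDeriv_one, deriv_sub_const,
      deriv_fun_div hf.differentiableAt hg.differentiableAt hg₀, hfg, hderiv]
    ring

end AnalyticAt

namespace CompactedTree

/-- The number of stacks with a fresh top, in the scale in which the recursion has bounded
coefficients; the index `j` stands for the height `j + 1`. -/
noncomputable def scaledCount (k m j : ℕ) : ℝ :=
  (freshStacks k m (j + 1)).ncard / (m ! * ((m : ℝ) + 1) ^ (j + 1))

/-- The expansion variable `1 / (m + 1)` of the recursion at step `m`. -/
noncomputable def invSucc (m : ℕ) : ℝ := 1 / (m + 1)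

/-- The coefficients of the recursion for `scaledCount`, as functions of `t = 1 / (m + 1)`. -/
noncomputable def stepCoeff (t : ℝ) (i j : ℕ) : ℝ :=
  ((1 + t) ^ (i + 1))⁻¹ * ((if j < i + 2 then 1 else 0) - (t - t ^ 2) * (if j < i then 1 else 0))

variable {k m i : ℕ} {t : ℝ}

theorem invSucc_pos (m : ℕ) : 0 < invSucc m := Nat.one_div_pos_of_nat

theorem tendsto_invSucc : Tendsto invSucc atTop (nhds 0) :=
  tendsto_one_div_add_atTop_nhds_zero_nat

theorem invSucc_succ (m : ℕ) : invSucc (m + 1) = invSucc m / (1 + invSucc m) := by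
  unfold invSucc
  push_cast
  field_simp

theorem one_add_invSucc (m : ℕ) : 1 + invSucc m = ((m : ℝ) + 2) / (m + 1) := by
  unfold invSucc
  field_simp
  ring

theorem summable_invSucc_sq : Summable fun m => invSucc m ^ 2 := by
  refine ((summable_nat_add_iff 1).2 (Real.summable_one_div_nat_pow.2 one_lt_two)).congr
    fun m => ?_
  rw [invSucc, div_pow, one_pow, Nat.cast_add_one]

theorem sum_scaledCount (k : ℕ) (hm : m ≠ 0) (h : ℕ) :
    ∑ j ∈ Finset.range h, scaledCount k m j =
      (stackSet k m h).ncard / (m ! * ((m : ℝ) + 1) ^ h) := by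
  induction h with
  | zero => simp [stackSet_zero_right, hm]
  | succ h ih =>
    have hfac : (m ! : ℝ) ≠ 0 := by positivity
    rw [Finset.sum_range_succ, ih, ncard_stackSet_succ, scaledCount]
    push_cast
    field_simp
    ring

theorem ncard_stackSet_zero_left (k h : ℕ) : (stackSet k 0 h).ncard = 1 := by
  induction h with
  | zero => rw [stackSet_zero_right, if_pos rfl, Set.ncard_singleton]
  | succ h ih => rw [ncard_stackSet_succ, freshStacks_zero_left, Set.ncard_empty, ih]

theorem scaledCount_nonneg (k m j : ℕ) : 0 ≤ scaledCount k m j := by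
  unfold scaledCount; positivity

theorem scaledCount_top (k : ℕ) (hm : m ≠ 0) : scaledCount k m (k + 1) = 0 := by
  obtain ⟨m, rfl⟩ := Nat.exists_eq_succ_of_ne_zero hm
  simp [scaledCount, freshStacks_succ_succ_of_lt k.lt_succ_self]

theorem stepCoeff_nonneg (ht : 0 ≤ t) (i j : ℕ) : 0 ≤ stepCoeff t i j := by
  refine mul_nonneg (by positivity) ?_
  have hlt : 0 ≤ 1 - (t - t ^ 2) := by nlinarith [sq_nonneg (t - 1)]
  split_ifs <;> linarith

theorem stepCoeff_zero_pos (ht : 0 ≤ t) (i : ℕ) : 0 < stepCoeff t i 0 := by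
  refine mul_pos (by positivity) ?_
  have hlt : 0 < 1 - (t - t ^ 2) := by nlinarith [sq_nonneg (t - 1)]
  split_ifs <;> linarith

theorem sum_stepCoeff_mul (hi : i ≤ k) (t : ℝ) {f : ℕ → ℝ} (hf : f (k + 1) = 0) :
    ∑ j : Fin (k + 1), stepCoeff t i j * f j = ((1 + t) ^ (i + 1))⁻¹ *
      (∑ j ∈ Finset.range (i + 2), f j - (t - t ^ 2) * ∑ j ∈ Finset.range i, f j) := by
  have hrestrict : ∀ a ≤ k + 2, ∑ j ∈ Finset.range (k + 2), (if j < a then f j else 0) =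
      ∑ j ∈ Finset.range a, f j := by
    intro a ha
    rw [← Finset.sum_filter]
    congr 1
    ext j
    simp only [Finset.mem_filter, Finset.mem_range]
    omega
  have hextend : ∑ j : Fin (k + 1), stepCoeff t i j * f j =
      ∑ j ∈ Finset.range (k + 2), stepCoeff t i j * f j := by
    rw [Finset.sum_range_succ _ (k + 1), hf, mul_zero, add_zero,
      Fin.sum_univ_eq_sum_range (fun j => stepCoeff t i j * f j)]
  rw [hextend, ← hrestrict (i + 2) (by omega), ← hrestrict i (by omega), Finset.mul_sum,
    ← Finset.sum_sub_distrib, Finset.mul_sum]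
  refine Finset.sum_congr rfl fun j _ => ?_
  unfold stepCoeff
  split_ifs <;> ring

theorem scaledCount_succ (hm : m ≠ 0) (hi : i ≤ k) : scaledCount k (m + 1) i =
    ∑ j : Fin (k + 1), stepCoeff (invSucc m) i j * scaledCount k m j := by
  have hcount := congrArg (Nat.cast (R := ℝ)) (ncard_freshStacks_succ_succ hi m)
  have hfac : (m ! : ℝ) ≠ 0 := by positivity
  rw [sum_stepCoeff_mul hi _ (scaledCount_top k hm), sum_scaledCount k hm, sum_scaledCount k hm,
    ← hcount, scaledCount, Nat.factorial_succ, one_add_invSucc, invSucc]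
  push_cast
  rw [show (m : ℝ) + 1 + 1 = m + 2 by ring, div_pow]
  field_simp
  ring

theorem scaledCount_succ_pos_of_zero_pos (hm : m ≠ 0) (hi : i ≤ k) (h : 0 < scaledCount k m 0) :
    0 < scaledCount k (m + 1) i := by
  have ht := (invSucc_pos m).le
  rw [scaledCount_succ hm hi]
  exact Finset.sum_pos' (fun j _ => mul_nonneg (stepCoeff_nonneg ht _ _) (scaledCount_nonneg _ _ _))
    ⟨0, Finset.mem_univ _, mul_pos (stepCoeff_zero_pos ht i) h⟩

theorem scaledCount_succ_zero_pos (k m : ℕ) : 0 < scaledCount k (m + 1) 0 := by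
  induction m with
  | zero =>
    have hfresh := ncard_freshStacks_succ_succ (Nat.zero_le k) 0
    rw [ncard_stackSet_zero_left, ncard_stackSet_zero_left, zero_mul, add_zero] at hfresh
    simp [scaledCount, hfresh]
  | succ m ih => exact scaledCount_succ_pos_of_zero_pos m.succ_ne_zero (Nat.zero_le k) ih

theorem scaledCount_pos (hm : 2 ≤ m) (hi : i ≤ k) : 0 < scaledCount k m i := by
  obtain ⟨m, rfl⟩ := Nat.exists_eq_add_of_le' hm
  exact scaledCount_succ_pos_of_zero_pos m.succ_ne_zero hi (scaledCount_succ_zero_pos k m)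

/-- The partial sums of the Perron eigenvector with its first-order correction in `t`. -/
noncomputable def correctedSum (k : ℕ) (t : ℝ) (h : ℕ) : ℝ := perronSum k h + t * correction k h

/-- The Perron eigenvector with its first-order correction in `t`. -/
noncomputable def corrected (k : ℕ) (t : ℝ) (i : ℕ) : ℝ :=
  correctedSum k t (i + 1) - correctedSum k t i

/-- The corrected eigenvector one step later, where `t = 1 / (m + 1)` has become
`t / (1 + t) = 1 / (m + 2)`, in the scale of the previous step. -/
noncomputable def nextCorrected (k : ℕ) (t : ℝ) (i : ℕ) : ℝ :=
  growth k * (1 + t) ^ (criticalExponent k - 1) * corrected k (t / (1 + t)) i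

/-- The approximate solution of the recursion for `scaledCount`. -/
noncomputable def approxSol (k m i : ℕ) : ℝ :=
  growth k ^ m * ((m : ℝ) + 1) ^ (criticalExponent k - 1) * corrected k (invSucc m) i

theorem correctedSum_zero (k : ℕ) (t : ℝ) : correctedSum k t 0 = 0 := by
  simp [correctedSum, perronSum_zero, correction]

theorem sum_corrected (k : ℕ) (t : ℝ) (h : ℕ) :
    ∑ j ∈ Finset.range h, corrected k t j = correctedSum k t h := by
  simp only [corrected, Finset.sum_range_sub, correctedSum_zero, sub_zero]

theorem corrected_top (k : ℕ) (t : ℝ) : corrected k t (k + 1) = 0 := by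
  simp [corrected, correctedSum, perronSum_top, correction_top]

theorem corrected_zero_pos (hi : i ≤ k) : 0 < corrected k 0 i := by
  simpa [corrected, correctedSum] using perronSum_succ_sub_pos hi

theorem nextCorrected_zero (k i : ℕ) : nextCorrected k 0 i = growth k * corrected k 0 i := by
  simp [nextCorrected]

theorem nextCorrected_zero_pos (hi : i ≤ k) : 0 < nextCorrected k 0 i := by
  rw [nextCorrected_zero]
  exact mul_pos (growth_pos k) (corrected_zero_pos hi)

theorem hasDerivAt_correctedSum (k : ℕ) (t : ℝ) (h : ℕ) :
    HasDerivAt (correctedSum k · h) (correction k h) t := by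
  simpa [correctedSum] using
    ((hasDerivAt_id t).mul_const (correction k h)).const_add (perronSum k h)

theorem hasDerivAt_corrected (k : ℕ) (t : ℝ) (i : ℕ) :
    HasDerivAt (corrected k · i) (correction k (i + 1) - correction k i) t :=
  (hasDerivAt_correctedSum k t (i + 1)).sub (hasDerivAt_correctedSum k t i)

theorem hasDerivAt_nextCorrected (k i : ℕ) : HasDerivAt (nextCorrected k · i)
    (growth k * ((criticalExponent k - 1) * corrected k 0 i +
      (correction k (i + 1) - correction k i))) 0 := by
  have hbase : HasDerivAt (fun t : ℝ => 1 + t) 1 0 := (hasDerivAt_id 0).const_add 1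
  have hpow : HasDerivAt (fun t : ℝ => (1 + t) ^ (criticalExponent k - 1))
      (criticalExponent k - 1) 0 := by
    simpa using hbase.rpow_const (p := criticalExponent k - 1) (.inl (by simp))
  have harg : HasDerivAt (fun t : ℝ => t / (1 + t)) 1 0 := by
    simpa using (hasDerivAt_id' (0 : ℝ)).fun_div hbase (by simp)
  have hcomp := (hasDerivAt_corrected k (0 / (1 + 0)) i).comp 0 harg
  refine ((hpow.const_mul (growth k)).mul hcomp).congr_deriv ?_
  simp
  ring

theorem analyticAt_corrected (k : ℕ) (t : ℝ) (i : ℕ) : AnalyticAt ℝ (corrected k · i) t := by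
  unfold corrected correctedSum
  fun_prop

theorem analyticAt_nextCorrected (k i : ℕ) : AnalyticAt ℝ (nextCorrected k · i) 0 := by
  have hpow : ContDiffAt ℝ ⊤ (fun t : ℝ => (1 + t) ^ (criticalExponent k - 1)) 0 :=
    ContDiffAt.rpow_const_of_ne (by fun_prop) (by simp)
  have harg : AnalyticAt ℝ (fun t : ℝ => t / (1 + t)) 0 :=
    analyticAt_id.div (by fun_prop) (by simp)
  exact (analyticAt_const.mul hpow.analyticAt).mul ((analyticAt_corrected k _ i).comp harg)

theorem sum_stepCoeff_mul_corrected (hi : i ≤ k) (t : ℝ) :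
    ∑ j : Fin (k + 1), stepCoeff t i j * corrected k t j = ((1 + t) ^ (i + 1))⁻¹ *
      (correctedSum k t (i + 2) - (t - t ^ 2) * correctedSum k t i) := by
  rw [sum_stepCoeff_mul hi t (corrected_top k t), sum_corrected, sum_corrected]

theorem analyticAt_stepCoeff (i j : ℕ) : AnalyticAt ℝ (stepCoeff · i j) 0 := by
  unfold stepCoeff
  exact (AnalyticAt.inv (by fun_prop) (by simp)).mul (by fun_prop)

theorem analyticAt_sum_stepCoeff_mul_corrected (k i : ℕ) :
    AnalyticAt ℝ (fun t => ∑ j : Fin (k + 1), stepCoeff t i j * corrected k t j) 0 :=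
  Finset.univ.analyticAt_fun_sum fun j _ =>
    (analyticAt_stepCoeff i j).mul (analyticAt_corrected k 0 j)

theorem hasDerivAt_sum_stepCoeff_mul_corrected (hi : i ≤ k) :
    HasDerivAt (fun t => ∑ j : Fin (k + 1), stepCoeff t i j * corrected k t j)
      (correction k (i + 2) - perronSum k i - (i + 1) * perronSum k (i + 2)) 0 := by
  simp only [sum_stepCoeff_mul_corrected hi]
  have hbase : HasDerivAt (fun t : ℝ => 1 + t) 1 0 := (hasDerivAt_id 0).const_add 1
  have hinv : HasDerivAt (fun t : ℝ => ((1 + t) ^ (i + 1))⁻¹) (-(i + 1)) 0 := by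
    simpa using (hbase.fun_pow (i + 1)).fun_inv (by simp)
  have hquad : HasDerivAt (fun t : ℝ => t - t ^ 2) 1 0 := by
    simpa using (hasDerivAt_id' (0 : ℝ)).fun_sub (hasDerivAt_pow 2 (0 : ℝ))
  refine (hinv.mul ((hasDerivAt_correctedSum k 0 (i + 2)).sub
    (hquad.mul (hasDerivAt_correctedSum k 0 i)))).congr_deriv ?_
  simp [correctedSum]
  ring

theorem sum_stepCoeff_zero_mul_corrected (hi : i ≤ k) :
    ∑ j : Fin (k + 1), stepCoeff 0 i j * corrected k 0 j = nextCorrected k 0 i := by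
  rw [sum_stepCoeff_mul_corrected hi, nextCorrected_zero]
  simp [corrected, correctedSum, perronSum_add_two]

-- The correction and the critical exponent are chosen so that both sides agree to first order.
theorem isBigO_sum_stepCoeff_mul_corrected_div (hi : i ≤ k) :
    (fun t => (∑ j : Fin (k + 1), stepCoeff t i j * corrected k t j) / nextCorrected k t i - 1)
      =O[nhds 0] fun t => t ^ 2 := by
  have h := isBigO_div_sub_one_of_deriv_eq (analyticAt_sum_stepCoeff_mul_corrected k i)
    (analyticAt_nextCorrected k i) (nextCorrected_zero_pos hi).ne'
    (sum_stepCoeff_zero_mul_corrected hi) ?_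
  · simpa only [sub_zero] using h
  · rw [(hasDerivAt_sum_stepCoeff_mul_corrected hi).deriv, (hasDerivAt_nextCorrected k i).deriv,
      correction, correctionSource, perronSum_add_two]
    simp only [corrected, correctedSum, zero_mul, add_zero]
    ring

/-- The coefficients of the recursion for the ratios `scaledCount / approxSol`, as functions of
`t = 1 / (m + 1)`. -/
noncomputable def ratioMatrix (k : ℕ) (t : ℝ) : Matrix (Fin (k + 1)) (Fin (k + 1)) ℝ :=
  .of fun i j => stepCoeff t i j * corrected k t j / nextCorrected k t i

theorem summable_sum_ratioMatrix_sub_one (i : Fin (k + 1)) :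
    Summable fun m => ∑ j, ratioMatrix k (invSucc m) i j - 1 := by
  refine summable_of_isBigO_nat summable_invSucc_sq ?_
  simp only [ratioMatrix, Matrix.of_apply, ← Finset.sum_div]
  exact (isBigO_sum_stepCoeff_mul_corrected_div (Nat.lt_succ_iff.1 i.2)).comp_tendsto
    tendsto_invSucc

theorem eventually_corrected_pos (hi : i ≤ k) : ∀ᶠ t in nhds 0, 0 < corrected k t i :=
  (analyticAt_corrected k 0 i).continuousAt.eventually (lt_mem_nhds (corrected_zero_pos hi))

theorem eventually_nextCorrected_pos (hi : i ≤ k) : ∀ᶠ t in nhds 0, 0 < nextCorrected k t i :=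
  (analyticAt_nextCorrected k i).continuousAt.eventually (lt_mem_nhds (nextCorrected_zero_pos hi))

theorem eventually_ratioMatrix_nonneg (k : ℕ) :
    ∀ᶠ m in atTop, ∀ i j, 0 ≤ ratioMatrix k (invSucc m) i j := by
  refine eventually_all.2 fun i => eventually_all.2 fun j => ?_
  filter_upwards [tendsto_invSucc.eventually (eventually_corrected_pos (Nat.lt_succ_iff.1 j.2)),
    tendsto_invSucc.eventually (eventually_nextCorrected_pos (Nat.lt_succ_iff.1 i.2))] with m hj hi
  exact div_nonneg (mul_nonneg (stepCoeff_nonneg (invSucc_pos m).le _ _) hj.le) hi.le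

theorem exists_pos_le_ratioMatrix_zero (i : Fin (k + 1)) :
    ∃ δ > 0, ∀ᶠ m in atTop, δ ≤ ratioMatrix k (invSucc m) i 0 := by
  have hi := Nat.lt_succ_iff.1 i.2
  have hpos : 0 < ratioMatrix k 0 i 0 :=
    div_pos (mul_pos (stepCoeff_zero_pos le_rfl _) (corrected_zero_pos k.zero_le))
      (nextCorrected_zero_pos hi)
  have hcont : ContinuousAt (fun t => ratioMatrix k t i 0) 0 :=
    (((analyticAt_stepCoeff i 0).mul (analyticAt_corrected k 0 0)).div
      (analyticAt_nextCorrected k i) (nextCorrected_zero_pos hi).ne').continuousAt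
  exact ⟨_, half_pos hpos, (tendsto_invSucc.eventually
    (hcont.eventually (lt_mem_nhds (half_lt_self hpos)))).mono fun _ h => h.le⟩

theorem approxSol_succ (k m i : ℕ) : approxSol k (m + 1) i =
    growth k ^ m * ((m : ℝ) + 1) ^ (criticalExponent k - 1) * nextCorrected k (invSucc m) i := by
  have hm : (0 : ℝ) ≤ m + 1 := by positivity
  have ht : 0 ≤ 1 + invSucc m := by linarith [invSucc_pos m]
  have hmul : ((m + 1 : ℕ) : ℝ) + 1 = (m + 1) * (1 + invSucc m) := by
    rw [one_add_invSucc]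
    push_cast
    field_simp
    ring
  rw [approxSol, nextCorrected, hmul, Real.mul_rpow hm ht, invSucc_succ, pow_succ]
  ring

theorem eventually_approxSol_pos (k : ℕ) :
    ∀ᶠ m in atTop, ∀ i : Fin (k + 1), 0 < approxSol k m i := by
  refine eventually_all.2 fun i => ?_
  filter_upwards [tendsto_invSucc.eventually (eventually_corrected_pos (Nat.lt_succ_iff.1 i.2))]
    with m hm
  exact mul_pos (mul_pos (pow_pos (growth_pos k) _) (Real.rpow_pos_of_pos (by positivity) _)) hm

theorem eventually_scaledCount_div_approxSol_succ (k : ℕ) : ∀ᶠ m in atTop,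
    (fun i : Fin (k + 1) => scaledCount k (m + 1) i / approxSol k (m + 1) i) =
      (ratioMatrix k (invSucc m)).mulVec fun j => scaledCount k m j / approxSol k m j := by
  filter_upwards [eventually_ne_atTop 0, eventually_approxSol_pos k] with m hm hpos
  ext i
  rw [scaledCount_succ hm (Nat.lt_succ_iff.1 i.2), Finset.sum_div, Matrix.mulVec, dotProduct]
  refine Finset.sum_congr rfl fun j _ => ?_
  have hj := (hpos j).ne'
  simp only [ratioMatrix, Matrix.of_apply, approxSol_succ]
  rw [approxSol] at hj ⊢
  have hc := right_ne_zero_of_mul hj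
  rw [mul_div_mul_comm, div_mul_div_comm]
  field_simp

theorem exists_tendsto_scaledCount_div_approxSol (k : ℕ) : ∃ κ > 0, ∀ i : Fin (k + 1),
    Tendsto (fun m => scaledCount k m i / approxSol k m i) atTop (nhds κ) := by
  refine exists_pos_tendsto_of_mulVec 0 (eventually_scaledCount_div_approxSol_succ k) ?_
    (eventually_ratioMatrix_nonneg k) exists_pos_le_ratioMatrix_zero
    summable_sum_ratioMatrix_sub_one
  filter_upwards [eventually_ge_atTop 2, eventually_approxSol_pos k] with m hm hpos i
  exact div_pos (scaledCount_pos hm (Nat.lt_succ_iff.1 i.2)) (hpos i)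

theorem count_eq_scaledCount (k : ℕ) {n : ℕ} (hn : n ≠ 0) :
    (count k n : ℝ) = n ! * ((n : ℝ) + 1) * scaledCount k n 0 := by
  have hfac : (n ! : ℝ) ≠ 0 := by positivity
  have hsum := sum_scaledCount k hn 1
  rw [Finset.sum_range_one, pow_one] at hsum
  rw [count_eq_ncard_stackSet, hsum]
  field_simp

theorem isEquivalent_approxSol_zero (k : ℕ) :
    (fun n : ℕ => ((n : ℝ) + 1) * approxSol k n 0) ~[atTop]
      fun n : ℕ => corrected k 0 0 * growth k ^ n * (n : ℝ) ^ criticalExponent k := by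
  have hcorr : (fun n => corrected k (invSucc n) 0) ~[atTop] fun _ => corrected k 0 0 :=
    (isEquivalent_const_iff_tendsto (corrected_zero_pos k.zero_le).ne').2
      ((analyticAt_corrected k 0 0).continuousAt.tendsto.comp tendsto_invSucc)
  have hsucc : (fun n : ℕ => (n : ℝ) + 1) ~[atTop] fun n : ℕ => (n : ℝ) :=
    IsEquivalent.refl.add_isLittleO
      (isLittleO_const_left.2 (.inr (tendsto_norm_atTop_atTop.comp tendsto_natCast_atTop_atTop)))
  have hpow := hsucc.rpow (r := criticalExponent k) (fun n => n.cast_nonneg)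
  refine ((hcorr.mul .refl).mul hpow).congr_left (.of_forall fun n => ?_)
  have hn : (n : ℝ) + 1 ≠ 0 := by positivity
  simp only [approxSol, Real.rpow_sub_one hn, Pi.mul_apply, Pi.pow_apply]
  field_simp

theorem exists_isEquivalent_count (k : ℕ) : ∃ κ : ℝ, 0 < κ ∧
    (fun n : ℕ => (count k n : ℝ)) ~[atTop]
      fun n : ℕ => κ * (n ! : ℝ) * growth k ^ n * (n : ℝ) ^ criticalExponent k := by
  obtain ⟨κ, hκ, hlim⟩ := exists_tendsto_scaledCount_div_approxSol k
  refine ⟨κ * corrected k 0 0, mul_pos hκ (corrected_zero_pos k.zero_le), ?_⟩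
  have hratio := (isEquivalent_const_iff_tendsto hκ.ne').2 (hlim 0)
  have hfac : (fun n : ℕ => (n ! : ℝ)) ~[atTop] fun n : ℕ => (n ! : ℝ) := .refl
  refine (((hratio.mul hfac).mul (isEquivalent_approxSol_zero k)).congr_left ?_).congr_right
    (.of_forall fun n => ?_)
  · filter_upwards [eventually_ne_atTop 0, eventually_approxSol_pos k] with n hn hpos
    have h0 : approxSol k n 0 ≠ 0 := (hpos 0).ne'
    simp only [count_eq_scaledCount k hn, Pi.mul_apply, Fin.val_zero]
    field_simp
  · simp only [Pi.mul_apply, Function.const_apply]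
    ring

end CompactedTree

theorem theorem3p2 (k : ℕ) :
    (∃ κ : ℝ, 0 < κ ∧
      (fun n : ℕ => (CompactedTree.count k n : ℝ)) ~[atTop]
        (fun n : ℕ => κ * (n ! : ℝ) * (4 * Real.cos (Real.pi / ((k : ℝ) + 3)) ^ 2) ^ n
          * (n : ℝ) ^ CompactedTree.criticalExponent k)) ∧
    (Irrational (CompactedTree.criticalExponent k) ↔ k ≠ 0 ∧ k ≠ 1 ∧ k ≠ 3) :=
  ⟨CompactedTree.exists_isEquivalent_count k, CompactedTree.irrational_criticalExponent_iff k⟩
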